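/- For every real $x>0$ there is exactly one real number $m(x)>0$, the median of the gamma distribution with shape parameter $x$ (and rate $1$), such that $$\int_0^{m(x)} e^{-t}t^{x-1}\,dt=\frac12\int_0^\infty e^{-t}t^{x-1}\,dt .$$ The function $m$ so defined on $(0,\infty)$ is twice differentiable and satisfies $m''(x)>0$ for all $x>0$. In particular, $m$ is strictly convex on the positive half-line $(0,\infty)$. -/

import Mathlib

/-- `a` is the median of the gamma distribution with shape parameter `x` (and rate `1`):
`a > 0` and `∫_0^a e^{-t} t^{x-1} dt = (1/2) ∫_0^∞ e^{-t} t^{x-1} dt`. Positivity of `a` keeps the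
integral on the half-line that carries the distribution. -/
def IsGammaMedian (x a : ℝ) : Prop :=
  0 < a ∧
    ∫ t in (0 : ℝ)..a, Real.exp (-t) * t ^ (x - 1) =
      (1 / 2) * ∫ t in Set.Ioi (0 : ℝ), Real.exp (-t) * t ^ (x - 1)

/-! Substituting `t = a s`, `a` is the median iff `∫ sgn(1-s) e^{-as} s^{x-1} ds = 0` over the
half-line. Write `W` for this signed weight. Differentiating in `x` inserts `log s`, in `a` inserts
`-s`. Implicit differentiation gives `b = m'(x) > 0` with `∫ W (log s - b s) = 0`, and then `m''(x)
∫ W s = ∫ W (log s - b s)²`. As `∫ W s < 0`, convexity amounts to negativity of the second moment on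
the right, where `W` is orthogonal to both `1` and `log s - b s`
(`integral_signedWeight_mul_sq_neg`).

With `v = b s`, the function `log v - v` takes each value below its maximum twice, at `v₋ < 1 < v₊`.
With `δ = log (v₊ / v₋)`, equality of the values forces `v₊ - v₋ = δ`, so both branches are
explicit. Folding the integrals along them gives a density in `δ` and a strictly decreasing `y(δ)`.
Where the two branches lie on opposite sides of `s = 1`, the density has the sign of `A - e^{cδ} B`,
with `A = lowerDensity`, `B = upperDensity`, `c = x - a/b`. This changes sign at most once, from
plus to minus, because `log (A/B)` is positive and strictly concave, hence `log (A/B) / δ` is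
decreasing; the concavity reduces to `A < e^{δ/3} B`.

If `b ≥ 1` the folded density is first positive, then negative, which the two orthogonality
relations exclude. If `b < 1` the signs run minus, plus, minus, and comparison with a quadratic in
`y` having its zeros at the sign changes makes the second moment negative. -/

/-! ### Inequalities between the two branch densities -/

theorem pos_of_hasDerivAt_pos {f f' : ℝ → ℝ} (h : ∀ x, HasDerivAt f (f' x) x) (h0 : f 0 = 0)
    (hp : ∀ x, 0 < x → 0 < f' x) {x : ℝ} (hx : 0 < x) : 0 < f x := by
  have hm : StrictMonoOn f (Set.Ici 0) := by
    refine strictMonoOn_of_deriv_pos (convex_Ici 0)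
      (fun y _ => (h y).continuousAt.continuousWithinAt) fun y hy => ?_
    rw [interior_Ici] at hy
    rw [(h y).deriv]
    exact hp y hy
  simpa [h0] using hm (Set.mem_Ici.2 le_rfl) (Set.mem_Ici.2 hx.le) hx

/-- Up to the factor `(e^δ - 1)⁻²`, minus the derivative of `lowerBranch`. -/
noncomputable def lowerDensity (δ : ℝ) : ℝ := Real.exp δ * (δ - 1) + 1

/-- Up to the factor `e^δ (e^δ - 1)⁻²`, the derivative of `upperBranch`. -/
noncomputable def upperDensity (δ : ℝ) : ℝ := Real.exp δ - 1 - δ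

theorem hasDerivAt_lowerDensity (δ : ℝ) : HasDerivAt lowerDensity (δ * Real.exp δ) δ := by
  have := ((Real.hasDerivAt_exp δ).mul ((hasDerivAt_id δ).sub_const 1)).add_const 1
  refine this.congr_deriv ?_
  simp; ring

theorem hasDerivAt_upperDensity (δ : ℝ) : HasDerivAt upperDensity (Real.exp δ - 1) δ :=
  ((Real.hasDerivAt_exp δ).sub_const 1).sub (hasDerivAt_id δ)

theorem exp_sub_one_pos {δ : ℝ} (h : 0 < δ) : 0 < Real.exp δ - 1 := by
  have := Real.one_lt_exp_iff.2 h
  linarith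

theorem upperDensity_pos {δ : ℝ} (h : 0 < δ) : 0 < upperDensity δ := by
  have := Real.add_one_lt_exp h.ne'
  unfold upperDensity; linarith

theorem lowerDensity_pos {δ : ℝ} (h : 0 < δ) : 0 < lowerDensity δ :=
  pos_of_hasDerivAt_pos hasDerivAt_lowerDensity (by simp [lowerDensity])
    (fun x hx => mul_pos hx (Real.exp_pos x)) h

theorem upperDensity_lt_lowerDensity {δ : ℝ} (h : 0 < δ) : upperDensity δ < lowerDensity δ := by
  have key : 0 < lowerDensity δ - upperDensity δ := by
    refine pos_of_hasDerivAt_pos (f := fun δ => lowerDensity δ - upperDensity δ)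
      (fun x => (hasDerivAt_lowerDensity x).sub (hasDerivAt_upperDensity x))
      (by simp [lowerDensity, upperDensity]) (fun x hx => ?_) h
    have := lowerDensity_pos hx
    unfold lowerDensity at this
    linarith
  linarith

theorem hasDerivAt_exp_mul (c x : ℝ) :
    HasDerivAt (fun x => Real.exp (c * x)) (c * Real.exp (c * x)) x := by
  have := ((hasDerivAt_id x).const_mul c).exp
  refine this.congr_deriv ?_
  simp; ring

/-- The difference and, up to positive factors, its successive derivatives vanish at `0`; after
three differentiations only `e^{δ/3} - 1 - δ/3 > 0` remains. The rate `1/3` is what concavity of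
`logDensityRatio` needs. -/
theorem lowerDensity_lt_exp_mul_upperDensity {δ : ℝ} (h : 0 < δ) :
    lowerDensity δ < Real.exp (1 / 3 * δ) * upperDensity δ := by
  have h2 : ∀ x : ℝ, 0 < x →
      0 < 4 / 3 * Real.exp x - 1 / 3 - Real.exp (2 / 3 * x) * (1 + 2 / 3 * x) := by
    intro x hx
    refine pos_of_hasDerivAt_pos
      (f := fun x => 4 / 3 * Real.exp x - 1 / 3 - Real.exp (2 / 3 * x) * (1 + 2 / 3 * x))
      (f' := fun x => 4 / 3 * Real.exp (2 / 3 * x) * (Real.exp (1 / 3 * x) - 1 - 1 / 3 * x))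
      (fun x => ?_) (by norm_num) (fun x hx => ?_) hx
    · have := (((Real.hasDerivAt_exp x).const_mul (4 / 3)).sub_const (1 / 3)).sub
        ((hasDerivAt_exp_mul (2 / 3) x).mul (((hasDerivAt_id x).const_mul (2 / 3)).const_add 1))
      refine this.congr_deriv ?_
      have e : Real.exp x = Real.exp (2 / 3 * x) * Real.exp (1 / 3 * x) := by
        rw [← Real.exp_add]; ring_nf
      rw [e]; simp; ring
    · have := upperDensity_pos (δ := 1 / 3 * x) (by positivity)
      unfold upperDensity at this
      positivity
  have h1 : ∀ x : ℝ, 0 < x →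
      0 < 4 / 3 * Real.exp x - 4 / 3 - 1 / 3 * x - x * Real.exp (2 / 3 * x) := by
    intro x hx
    refine pos_of_hasDerivAt_pos
      (f := fun x => 4 / 3 * Real.exp x - 4 / 3 - 1 / 3 * x - x * Real.exp (2 / 3 * x))
      (fun x => ?_) (by norm_num) h2 hx
    have := ((((Real.hasDerivAt_exp x).const_mul (4 / 3)).sub_const (4 / 3)).sub
        ((hasDerivAt_id x).const_mul (1 / 3))).sub
        ((hasDerivAt_id x).mul (hasDerivAt_exp_mul (2 / 3) x))
    refine this.congr_deriv ?_
    simp; ring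
  have key : 0 < Real.exp (1 / 3 * δ) * upperDensity δ - lowerDensity δ := by
    refine pos_of_hasDerivAt_pos
      (f := fun x => Real.exp (1 / 3 * x) * upperDensity x - lowerDensity x)
      (f' := fun x => Real.exp (1 / 3 * x) *
        (4 / 3 * Real.exp x - 4 / 3 - 1 / 3 * x - x * Real.exp (2 / 3 * x)))
      (fun x => ?_) (by simp [lowerDensity, upperDensity])
      (fun x hx => mul_pos (Real.exp_pos _) (h1 x hx)) h
    have := ((hasDerivAt_exp_mul (1 / 3) x).mul (hasDerivAt_upperDensity x)).sub
      (hasDerivAt_lowerDensity x)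
    refine this.congr_deriv ?_
    have e : Real.exp x = Real.exp (1 / 3 * x) * Real.exp (2 / 3 * x) := by
      rw [← Real.exp_add]; ring_nf
    unfold upperDensity
    linear_combination (-x) * e
  linarith

/-! ### Concavity of the log ratio and single crossing -/

noncomputable def logDensityRatio (δ : ℝ) : ℝ :=
  Real.log (lowerDensity δ) - Real.log (upperDensity δ)

theorem hasDerivAt_logDensityRatio {δ : ℝ} (h : 0 < δ) :
    HasDerivAt logDensityRatio
      (δ * Real.exp δ / lowerDensity δ - (Real.exp δ - 1) / upperDensity δ) δ :=
  ((hasDerivAt_lowerDensity δ).log (lowerDensity_pos h).ne').sub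
    ((hasDerivAt_upperDensity δ).log (upperDensity_pos h).ne')

theorem strictConcaveOn_logDensityRatio : StrictConcaveOn ℝ (Set.Ioi 0) logDensityRatio := by
  refine strictConcaveOn_of_deriv2_neg (convex_Ioi 0)
    (fun δ h => (hasDerivAt_logDensityRatio h).continuousAt.continuousWithinAt) fun δ h => ?_
  rw [interior_Ioi, Set.mem_Ioi] at h
  have hA := lowerDensity_pos h
  have hB := upperDensity_pos h
  have e : deriv logDensityRatio =ᶠ[nhds δ] fun δ =>
      δ * Real.exp δ / lowerDensity δ - (Real.exp δ - 1) / upperDensity δ := by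
    filter_upwards [lt_mem_nhds h] with z hz using (hasDerivAt_logDensityRatio hz).deriv
  have hd := (((hasDerivAt_id δ).mul (Real.hasDerivAt_exp δ)).div
    (hasDerivAt_lowerDensity δ) hA.ne').sub
    (((Real.hasDerivAt_exp δ).sub_const 1).div (hasDerivAt_upperDensity δ) hB.ne')
  rw [Function.iterate_succ, Function.iterate_one, Function.comp_apply, e.deriv_eq]
  refine lt_of_eq_of_lt hd.deriv ?_
  -- The second derivative is `A/B² - e^δ B/A²`, negative exactly when `A³ < e^δ B³`.
  have h3 : lowerDensity δ ^ 3 < Real.exp δ * upperDensity δ ^ 3 := by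
    have := pow_lt_pow_left₀ (lowerDensity_lt_exp_mul_upperDensity h) hA.le (n := 3) (by norm_num)
    rw [mul_pow, ← Real.exp_nat_mul] at this
    rwa [show ((3 : ℕ) : ℝ) * (1 / 3 * δ) = δ by push_cast; ring] at this
  have e1 : (1 * Real.exp δ + id δ * Real.exp δ) * lowerDensity δ
      - ((id : ℝ → ℝ) * Real.exp) δ * (δ * Real.exp δ) = - (Real.exp δ * upperDensity δ) := by
    simp [lowerDensity, upperDensity]; ring
  have e2 : Real.exp δ * upperDensity δ - (Real.exp δ - 1) * (Real.exp δ - 1)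
      = - lowerDensity δ := by
    simp [lowerDensity, upperDensity]; ring
  rw [e1, e2, sub_neg, div_lt_div_iff₀ (by positivity) (by positivity)]
  nlinarith

theorem logDensityRatio_pos {δ : ℝ} (h : 0 < δ) : 0 < logDensityRatio δ :=
  sub_pos.2 (Real.log_lt_log (upperDensity_pos h) (upperDensity_lt_lowerDensity h))

/-- A positive strictly concave function on the open half-line has strictly decreasing slope from
the origin. -/
theorem logDensityRatio_mul_lt {t d : ℝ} (ht : 0 < t) (htd : t < d) :
    t * logDensityRatio d < d * logDensityRatio t := by
  have hd := ht.trans htd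
  have weak : ∀ r, 0 < r → r < d → r * logDensityRatio d ≤ d * logDensityRatio r := by
    intro r hr hrd
    -- The origin lies outside the domain, so the chord starts at `ε`, its positive endpoint value
    -- is dropped, and `ε → 0`. Strictness is lost in the limit and recovered below from a fixed `ε
    -- < t`.
    have step : ∀ ε ∈ Set.Ioo 0 r, (r - ε) * logDensityRatio d ≤ (d - ε) * logDensityRatio r := by
      rintro ε ⟨h0, h1⟩
      have h3 : 0 < d - ε := by linarith
      have ha : 0 ≤ (d - r) / (d - ε) := div_nonneg (by linarith) h3.le
      have hb : 0 ≤ (r - ε) / (d - ε) := div_nonneg (by linarith) h3.le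
      have h2 := strictConcaveOn_logDensityRatio.concaveOn.2 (Set.mem_Ioi.2 h0) (Set.mem_Ioi.2 hd)
        ha hb (by field_simp; ring)
      have e : ((d - r) / (d - ε)) • ε + ((r - ε) / (d - ε)) • d = r := by
        simp only [smul_eq_mul]; field_simp; ring
      rw [e] at h2
      simp only [smul_eq_mul] at h2
      have h4 : 0 ≤ (d - r) / (d - ε) * logDensityRatio ε :=
        mul_nonneg (div_nonneg (by linarith) h3.le) (logDensityRatio_pos h0).le
      have h5 : (r - ε) / (d - ε) * logDensityRatio d ≤ logDensityRatio r := by linarith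
      rw [div_mul_eq_mul_div, div_le_iff₀ h3] at h5
      linarith
    have l1 : Filter.Tendsto (fun ε : ℝ => (r - ε) * logDensityRatio d) (nhdsWithin 0 (Set.Ioi 0))
        (nhds ((r - 0) * logDensityRatio d)) :=
      (Continuous.tendsto (by fun_prop) 0).mono_left nhdsWithin_le_nhds
    have l2 : Filter.Tendsto (fun ε : ℝ => (d - ε) * logDensityRatio r) (nhdsWithin 0 (Set.Ioi 0))
        (nhds ((d - 0) * logDensityRatio r)) :=
      (Continuous.tendsto (by fun_prop) 0).mono_left nhdsWithin_le_nhds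
    have := le_of_tendsto_of_tendsto l1 l2
      (Filter.eventually_of_mem (Ioo_mem_nhdsGT hr) step)
    simpa using this
  obtain ⟨ε, h0, h1⟩ := exists_between ht
  have w := weak ε h0 (h1.trans htd)
  have h3 : 0 < d - ε := by linarith
  have ha : 0 < (d - t) / (d - ε) := div_pos (by linarith) h3
  have hb : 0 < (t - ε) / (d - ε) := div_pos (by linarith) h3
  have h2 := strictConcaveOn_logDensityRatio.2 (Set.mem_Ioi.2 h0) (Set.mem_Ioi.2 hd)
    (by linarith) ha hb (by field_simp; ring)
  have e : ((d - t) / (d - ε)) • ε + ((t - ε) / (d - ε)) • d = t := by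
    simp only [smul_eq_mul]; field_simp; ring
  rw [e] at h2
  simp only [smul_eq_mul] at h2
  rw [div_mul_eq_mul_div, div_mul_eq_mul_div, ← add_div, div_lt_iff₀ h3] at h2
  have h6 := mul_le_mul_of_nonneg_left w (show 0 ≤ d - t by linarith)
  have h7 := mul_lt_mul_of_pos_left h2 hd
  refine lt_of_mul_lt_mul_right (a := d - ε) ?_ h3.le
  linarith

/-- The exponentially tilted densities cross at most once. -/
theorem exp_mul_upperDensity_lt {c t d : ℝ} (ht : 0 < t) (htd : t < d)
    (h : Real.exp (c * d) * upperDensity d ≤ lowerDensity d) :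
    Real.exp (c * t) * upperDensity t < lowerDensity t := by
  have hd := ht.trans htd
  have h1 : c * d ≤ logDensityRatio d := by
    rw [logDensityRatio, le_sub_iff_add_le, ← Real.log_exp (c * d),
      ← Real.log_mul (Real.exp_pos _).ne' (upperDensity_pos hd).ne']
    exact Real.log_le_log (mul_pos (Real.exp_pos _) (upperDensity_pos hd)) h
  have h2 : c * t < logDensityRatio t := by
    have := logDensityRatio_mul_lt ht htd
    have := mul_le_mul_of_nonneg_left h1 ht.le
    refine lt_of_mul_lt_mul_left (a := d) ?_ hd.le
    linarith
  rw [logDensityRatio, lt_sub_iff_add_lt, ← Real.log_exp (c * t),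
      ← Real.log_mul (Real.exp_pos _).ne' (upperDensity_pos ht).ne'] at h2
  exact (Real.log_lt_log_iff (mul_pos (Real.exp_pos _) (upperDensity_pos ht))
    (lowerDensity_pos ht)).1 h2

/-! ### The branches of `log v - v` and folding of integrals -/

open MeasureTheory

/-- The preimage in `(0,1)` of a value of `v ↦ log v - v`, parametrized by the logarithm of its
ratio to the preimage in `(1,∞)`. -/
noncomputable def lowerBranch (δ : ℝ) : ℝ := δ / (Real.exp δ - 1)

noncomputable def upperBranch (δ : ℝ) : ℝ := lowerBranch δ + δ

theorem lowerBranch_pos {δ : ℝ} (h : 0 < δ) : 0 < lowerBranch δ :=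
  div_pos h (exp_sub_one_pos h)

theorem lowerBranch_lt_one {δ : ℝ} (h : 0 < δ) : lowerBranch δ < 1 := by
  rw [lowerBranch, div_lt_one (exp_sub_one_pos h)]
  have := upperDensity_pos h
  unfold upperDensity at this; linarith

theorem upperBranch_eq {δ : ℝ} (h : 0 < δ) : upperBranch δ = lowerBranch δ * Real.exp δ := by
  have := (exp_sub_one_pos h).ne'
  unfold upperBranch lowerBranch
  field_simp; ring

theorem one_lt_upperBranch {δ : ℝ} (h : 0 < δ) : 1 < upperBranch δ := by
  rw [upperBranch_eq h, lowerBranch, div_mul_eq_mul_div, one_lt_div (exp_sub_one_pos h)]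
  have := lowerDensity_pos h
  unfold lowerDensity at this; linarith

theorem log_upperBranch {δ : ℝ} (h : 0 < δ) :
    Real.log (upperBranch δ) = Real.log (lowerBranch δ) + δ := by
  rw [upperBranch_eq h, Real.log_mul (lowerBranch_pos h).ne' (Real.exp_pos _).ne', Real.log_exp]

theorem hasDerivAt_lowerBranch {δ : ℝ} (h : 0 < δ) :
    HasDerivAt lowerBranch (-(lowerDensity δ / (Real.exp δ - 1) ^ 2)) δ := by
  have := (hasDerivAt_id δ).div ((Real.hasDerivAt_exp δ).sub_const 1) (exp_sub_one_pos h).ne'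
  refine this.congr_deriv ?_
  unfold lowerDensity
  rw [← neg_div]
  simp; ring

theorem hasDerivAt_upperBranch {δ : ℝ} (h : 0 < δ) :
    HasDerivAt upperBranch (Real.exp δ * upperDensity δ / (Real.exp δ - 1) ^ 2) δ := by
  refine ((hasDerivAt_lowerBranch h).add (hasDerivAt_id δ)).congr_deriv ?_
  have := (exp_sub_one_pos h).ne'
  unfold lowerDensity upperDensity
  field_simp; ring

theorem strictAntiOn_lowerBranch : StrictAntiOn lowerBranch (Set.Ioi 0) := by
  refine strictAntiOn_of_deriv_neg (convex_Ioi 0)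
    (fun δ h => (hasDerivAt_lowerBranch h).continuousAt.continuousWithinAt) fun δ h => ?_
  rw [interior_Ioi] at h
  rw [(hasDerivAt_lowerBranch h).deriv, neg_lt_zero]
  exact div_pos (lowerDensity_pos h) (pow_pos (exp_sub_one_pos h) 2)

theorem strictMonoOn_upperBranch : StrictMonoOn upperBranch (Set.Ioi 0) := by
  refine strictMonoOn_of_deriv_pos (convex_Ioi 0)
    (fun δ h => (hasDerivAt_upperBranch h).continuousAt.continuousWithinAt) fun δ h => ?_
  rw [interior_Ioi] at h
  rw [(hasDerivAt_upperBranch h).deriv]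
  exact div_pos (mul_pos (Real.exp_pos _) (upperDensity_pos h)) (pow_pos (exp_sub_one_pos h) 2)

theorem image_lowerBranch : lowerBranch '' Set.Ioi 0 = Set.Ioo 0 1 := by
  ext v
  constructor
  · rintro ⟨δ, h, rfl⟩
    exact ⟨lowerBranch_pos h, lowerBranch_lt_one h⟩
  · rintro ⟨h0, h1⟩
    -- At `δ = 1 - v`, `lowerBranch δ = upperBranch δ - δ > 1 - δ = v`.
    have h2 : v < lowerBranch (1 - v) := by
      have := one_lt_upperBranch (δ := 1 - v) (by linarith)
      unfold upperBranch at this; linarith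
    -- From `e^δ - 1 ≥ δ + δ²/2`, `lowerBranch δ ≤ 1 / (1 + δ/2)`, which is `v / (v + 1)` at `δ = 2
    -- / v`.
    have h3 : lowerBranch (2 / v) < v := by
      have hp : 0 < 2 / v := by positivity
      have := Real.quadratic_le_exp_of_nonneg hp.le
      rw [lowerBranch, div_lt_iff₀ (exp_sub_one_pos hp)]
      have e1 : v * (2 / v) = 2 := by field_simp
      have e2 : v * ((2 / v) ^ 2 / 2) = 2 / v := by field_simp
      nlinarith
    have := isPreconnected_Ioi.intermediate_value (Set.mem_Ioi.2 (by positivity : 0 < 2 / v))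
      (Set.mem_Ioi.2 (by linarith : 0 < 1 - v))
      (f := lowerBranch) (fun δ h => (hasDerivAt_lowerBranch h).continuousAt.continuousWithinAt)
    exact this ⟨h3.le, h2.le⟩

theorem image_upperBranch : upperBranch '' Set.Ioi 0 = Set.Ioi 1 := by
  ext v
  constructor
  · rintro ⟨δ, h, rfl⟩
    exact one_lt_upperBranch h
  · intro h1
    rw [Set.mem_Ioi] at h1
    have h2 : v < upperBranch v := by
      have := lowerBranch_pos (δ := v) (by linarith)
      unfold upperBranch; linarith
    have h3 : upperBranch (v - 1) < v := by
      have := lowerBranch_lt_one (δ := v - 1) (by linarith)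
      unfold upperBranch; linarith
    have := isPreconnected_Ioi.intermediate_value (Set.mem_Ioi.2 (by linarith : 0 < v - 1))
      (Set.mem_Ioi.2 (by linarith : 0 < v))
      (f := upperBranch) (fun δ h => (hasDerivAt_upperBranch h).continuousAt.continuousWithinAt)
    exact this ⟨h3.le, h2.le⟩

/-- The integral over the half-line, folded along the two branches. -/
theorem integral_eq_integral_branches {f : ℝ → ℝ} (hf : IntegrableOn f (Set.Ioi 0)) :
    IntegrableOn (fun δ => lowerDensity δ / (Real.exp δ - 1) ^ 2 * f (lowerBranch δ) +
      Real.exp δ * upperDensity δ / (Real.exp δ - 1) ^ 2 * f (upperBranch δ)) (Set.Ioi 0) ∧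
    ∫ δ in Set.Ioi 0, (lowerDensity δ / (Real.exp δ - 1) ^ 2 * f (lowerBranch δ) +
      Real.exp δ * upperDensity δ / (Real.exp δ - 1) ^ 2 * f (upperBranch δ)) =
      ∫ v in Set.Ioi 0, f v := by
  have d1 : ∀ δ ∈ Set.Ioi (0 : ℝ), HasDerivWithinAt lowerBranch
      (-(lowerDensity δ / (Real.exp δ - 1) ^ 2)) (Set.Ioi 0) δ :=
    fun δ h => (hasDerivAt_lowerBranch h).hasDerivWithinAt
  have d2 : ∀ δ ∈ Set.Ioi (0 : ℝ), HasDerivWithinAt upperBranch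
      (Real.exp δ * upperDensity δ / (Real.exp δ - 1) ^ 2) (Set.Ioi 0) δ :=
    fun δ h => (hasDerivAt_upperBranch h).hasDerivWithinAt
  have c1 : Set.EqOn (fun δ => |-(lowerDensity δ / (Real.exp δ - 1) ^ 2)| • f (lowerBranch δ))
      (fun δ => lowerDensity δ / (Real.exp δ - 1) ^ 2 * f (lowerBranch δ)) (Set.Ioi 0) := by
    intro δ h
    have := div_pos (lowerDensity_pos h) (pow_pos (exp_sub_one_pos h) 2)
    simp only [abs_neg, abs_of_pos this, smul_eq_mul]
  have c2 : Set.EqOn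
      (fun δ => |Real.exp δ * upperDensity δ / (Real.exp δ - 1) ^ 2| • f (upperBranch δ))
      (fun δ => Real.exp δ * upperDensity δ / (Real.exp δ - 1) ^ 2 * f (upperBranch δ))
      (Set.Ioi 0) := by
    intro δ h
    have := div_pos (mul_pos (Real.exp_pos δ) (upperDensity_pos h)) (pow_pos (exp_sub_one_pos h) 2)
    simp only [abs_of_pos this, smul_eq_mul]
  have i1 := integrableOn_image_iff_integrableOn_abs_deriv_smul measurableSet_Ioi d1
    strictAntiOn_lowerBranch.injOn f
  have i2 := integrableOn_image_iff_integrableOn_abs_deriv_smul measurableSet_Ioi d2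
    strictMonoOn_upperBranch.injOn f
  have e1 := integral_image_eq_integral_abs_deriv_smul measurableSet_Ioi d1
    strictAntiOn_lowerBranch.injOn f
  have e2 := integral_image_eq_integral_abs_deriv_smul measurableSet_Ioi d2
    strictMonoOn_upperBranch.injOn f
  rw [image_lowerBranch, integrableOn_congr_fun c1 measurableSet_Ioi] at i1
  rw [image_upperBranch, integrableOn_congr_fun c2 measurableSet_Ioi] at i2
  rw [image_lowerBranch, setIntegral_congr_fun measurableSet_Ioi c1] at e1
  rw [image_upperBranch, setIntegral_congr_fun measurableSet_Ioi c2] at e2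
  have f1 : IntegrableOn f (Set.Ioo 0 1) := hf.mono_set Set.Ioo_subset_Ioi_self
  have f2 : IntegrableOn f (Set.Ioi 1) := hf.mono_set (Set.Ioi_subset_Ioi zero_le_one)
  refine ⟨(i1.1 f1).add (i2.1 f2), ?_⟩
  rw [integral_add (i1.1 f1) (i2.1 f2), ← e1, ← e2, ← integral_Ioc_eq_integral_Ioo,
    ← setIntegral_union (Set.Ioc_disjoint_Ioi le_rfl) measurableSet_Ioi
      (hf.mono_set Set.Ioc_subset_Ioi_self) f2, Set.Ioc_union_Ioi_eq_Ioi zero_le_one]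

/-- `integral_eq_integral_branches` after the scaling `v = b s`. -/
theorem integral_eq_integral_branches_div {f : ℝ → ℝ} (hf : IntegrableOn f (Set.Ioi 0)) {b : ℝ}
    (hb : 0 < b) :
    IntegrableOn (fun δ => b⁻¹ * (lowerDensity δ / (Real.exp δ - 1) ^ 2 * f (b⁻¹ * lowerBranch δ) +
      Real.exp δ * upperDensity δ / (Real.exp δ - 1) ^ 2 * f (b⁻¹ * upperBranch δ)))
      (Set.Ioi 0) ∧
    ∫ δ in Set.Ioi 0, b⁻¹ * (lowerDensity δ / (Real.exp δ - 1) ^ 2 * f (b⁻¹ * lowerBranch δ) +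
      Real.exp δ * upperDensity δ / (Real.exp δ - 1) ^ 2 * f (b⁻¹ * upperBranch δ)) =
      ∫ s in Set.Ioi 0, f s := by
  have hb' := inv_pos.2 hb
  have h1 : IntegrableOn (fun v => f (b⁻¹ * v)) (Set.Ioi 0) := by
    rwa [integrableOn_Ioi_comp_mul_left_iff f 0 hb', mul_zero]
  obtain ⟨h2, h3⟩ := integral_eq_integral_branches h1
  refine ⟨h2.const_mul _, ?_⟩
  rw [integral_const_mul, h3, ← smul_eq_mul, integral_comp_mul_left_Ioi' f 0 hb', mul_zero]

/-! ### Sign patterns and orthogonality -/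

/-- Source of all strict inequalities between integrals below: a nonnegative function with zero
integral vanishes almost everywhere, so it cannot be positive throughout an interval. -/
theorem exists_eq_zero_of_setIntegral_eq_zero {f : ℝ → ℝ} (hi : IntegrableOn f (Set.Ioi 0))
    (h0 : ∀ t, 0 < t → 0 ≤ f t) (hz : ∫ t in Set.Ioi 0, f t = 0) {p q : ℝ} (hp : 0 ≤ p)
    (hpq : p < q) : ∃ t, p < t ∧ t < q ∧ f t = 0 := by
  have h1 := (setIntegral_eq_zero_iff_of_nonneg_ae
    ((ae_restrict_iff' measurableSet_Ioi).2 (Filter.Eventually.of_forall h0)) hi).1 hz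
  have h2 : f =ᵐ[volume.restrict (Set.Ioo p q)] 0 :=
    ae_restrict_of_ae_restrict_of_subset (fun t ht => lt_of_le_of_lt hp ht.1) h1
  have h3 : ∀ᵐ t ∂volume.restrict (Set.Ioo p q), t ∈ Set.Ioo p q :=
    ae_restrict_mem measurableSet_Ioo
  have : (ae (volume.restrict (Set.Ioo p q))).NeBot := by
    rw [ae_restrict_neBot]
    simp [hpq]
  obtain ⟨t, ht, ht'⟩ := (h2.and h3).exists
  exact ⟨t, ht'.1, ht'.2, ht⟩

theorem setIntegral_mul_sub_const {M y : ℝ → ℝ}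
    (i0 : IntegrableOn M (Set.Ioi 0)) (i1 : IntegrableOn (fun t => M t * y t) (Set.Ioi 0))
    (z0 : ∫ t in Set.Ioi 0, M t = 0) (z1 : ∫ t in Set.Ioi 0, M t * y t = 0) (κ : ℝ) :
    IntegrableOn (fun t => M t * (y t - κ)) (Set.Ioi 0) ∧
      ∫ t in Set.Ioi 0, M t * (y t - κ) = 0 := by
  have e : (fun t => M t * (y t - κ)) = fun t => M t * y t - M t * κ := by ext; ring
  rw [e]
  refine ⟨i1.sub (i0.mul_const κ), ?_⟩
  rw [integral_sub i1 (i0.mul_const κ), integral_mul_const, z0, z1]; simp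

/-- If the signed density `M` is orthogonal to `1` and `y` with `y` strictly decreasing, is negative
on `(0,p)`, and after `p` is first nonnegative and then nonpositive, then its second moment
in `y` is negative. -/
theorem setIntegral_mul_sq_neg {M y : ℝ → ℝ} (hy : StrictAntiOn y (Set.Ioi 0))
    (i0 : IntegrableOn M (Set.Ioi 0)) (i1 : IntegrableOn (fun t => M t * y t) (Set.Ioi 0))
    (i2 : IntegrableOn (fun t => M t * y t ^ 2) (Set.Ioi 0))
    (z0 : ∫ t in Set.Ioi 0, M t = 0) (z1 : ∫ t in Set.Ioi 0, M t * y t = 0)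
    {p : ℝ} (hp : 0 < p) (hneg : ∀ t, 0 < t → t < p → M t < 0)
    (hinit : ∀ t d, p ≤ t → t < d → 0 < M d → 0 ≤ M t) :
    ∫ t in Set.Ioi 0, M t * y t ^ 2 < 0 := by
  have hy' : ∀ s t, 0 < s → s < t → y t < y s := fun s t hs hst => hy hs (hs.trans hst) hst
  have hyle : ∀ s t, 0 < s → s ≤ t → y t ≤ y s := fun s t hs hst =>
    hy.antitoneOn hs (lt_of_lt_of_le hs hst) hst
  by_cases hP : ∃ d, p ≤ d ∧ 0 < M d
  swap
  · push Not at hP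
    obtain ⟨t, ht0, htp, ht⟩ := exists_eq_zero_of_setIntegral_eq_zero (f := fun t => - M t) i0.neg
      (fun t ht => by
        rcases lt_or_ge t p with h | h
        · linarith [hneg t ht h]
        · linarith [hP t h]) (by rw [integral_neg, z0, neg_zero]) le_rfl hp
    linarith [hneg t ht0 htp]
  by_cases hB : BddAbove {d | p ≤ d ∧ 0 < M d}
  swap
  -- Here `M` never turns nonpositive for good, so `M ≥ 0` after `p` and `M (y - y p) ≤ 0`
  -- everywhere, strictly before `p`.
  · obtain ⟨j1, j2⟩ := setIntegral_mul_sub_const i0 i1 z0 z1 (y p)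
    obtain ⟨t, ht0, htp, ht⟩ := exists_eq_zero_of_setIntegral_eq_zero
      (f := fun t => - (M t * (y t - y p))) j1.neg
      (fun t ht => by
        rcases lt_or_ge t p with h | h
        · linarith [mul_neg_of_neg_of_pos (hneg t ht h) (sub_pos.2 (hy' t p ht h))]
        · obtain ⟨d, hd, htd⟩ := not_bddAbove_iff.1 hB t
          linarith [mul_nonpos_of_nonneg_of_nonpos (hinit t d h htd hd.2)
            (sub_nonpos.2 (hyle p t hp h))]) (by rw [integral_neg, j2, neg_zero]) le_rfl hp
    linarith [mul_neg_of_neg_of_pos (hneg t ht0 htp) (sub_pos.2 (hy' t p ht0 htp))]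
  set q := sSup {d | p ≤ d ∧ 0 < M d} with hq
  have hpq : p ≤ q := by
    obtain ⟨d, hd⟩ := hP
    exact hd.1.trans (le_csSup hB hd)
  have hlt : ∀ t, p ≤ t → t < q → 0 ≤ M t := fun t ht htq => by
    obtain ⟨d, hd, htd⟩ := exists_lt_of_lt_csSup hP htq
    exact hinit t d ht htd hd.2
  have hgt : ∀ t, q < t → M t ≤ 0 := fun t ht => by
    by_contra! h
    exact absurd (le_csSup hB (⟨hpq.trans ht.le, h⟩ : t ∈ {d | p ≤ d ∧ 0 < M d})) (not_le.2 ht)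
  -- By orthogonality `y²` may be replaced by `(y - y p)(y - y q)`, whose sign is opposite to that
  -- of `M` on each of the three ranges.
  have e : (fun t => -(M t * ((y t - y p) * (y t - y q)))) =
      fun t => (y p + y q) * (M t * y t) - M t * y t ^ 2 - (y p * y q) * M t := by ext; ring
  have i3 : IntegrableOn (fun t => (y p + y q) * (M t * y t) - M t * y t ^ 2) (Set.Ioi 0) :=
    (i1.const_mul _).sub i2
  have j : IntegrableOn (fun t => -(M t * ((y t - y p) * (y t - y q)))) (Set.Ioi 0) := by
    rw [e]; exact i3.sub (i0.const_mul _)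
  have j' : ∫ t in Set.Ioi 0, -(M t * ((y t - y p) * (y t - y q))) =
      - ∫ t in Set.Ioi 0, M t * y t ^ 2 := by
    rw [e, integral_sub i3 (i0.const_mul _),
      integral_sub (i1.const_mul _) i2, integral_const_mul, integral_const_mul, z0, z1]
    ring
  have hstrict : ∀ t, 0 < t → t < p → 0 < -(M t * ((y t - y p) * (y t - y q))) :=
    fun t ht h => neg_pos.2 (mul_neg_of_neg_of_pos (hneg t ht h)
      (mul_pos (sub_pos.2 (hy' t p ht h)) (sub_pos.2 (hy' t q ht (h.trans_le hpq)))))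
  have hnn : ∀ t, 0 < t → 0 ≤ -(M t * ((y t - y p) * (y t - y q))) := by
    intro t ht
    rcases lt_or_ge t p with h | h
    · exact (hstrict t ht h).le
    have h1 := sub_nonpos.2 (hyle p t hp h)
    rcases lt_trichotomy t q with h' | h' | h'
    · exact neg_nonneg.2 (mul_nonpos_of_nonneg_of_nonpos (hlt t h h')
        (mul_nonpos_of_nonpos_of_nonneg h1 (sub_nonneg.2 (hy' t q ht h').le)))
    · simp [h']
    · exact neg_nonneg.2 (mul_nonpos_of_nonpos_of_nonneg (hgt t h') (mul_nonneg_of_nonpos_of_nonpos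
        h1 (sub_nonpos.2 (hy' q t (hp.trans_le hpq) h').le)))
  by_contra! hge
  have hz : ∫ t in Set.Ioi 0, -(M t * ((y t - y p) * (y t - y q))) = 0 :=
    le_antisymm (by linarith) (setIntegral_nonneg measurableSet_Ioi hnn)
  obtain ⟨t, ht0, htp, ht⟩ := exists_eq_zero_of_setIntegral_eq_zero j hnn hz le_rfl hp
  exact absurd ht (hstrict t ht0 htp).ne'

/-- A signed density that is first positive and then negative is not orthogonal to both `1` and a
strictly decreasing function. -/
theorem not_orthogonal_of_single_crossing {M y : ℝ → ℝ} (hy : StrictAntiOn y (Set.Ioi 0))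
    (i0 : IntegrableOn M (Set.Ioi 0)) (i1 : IntegrableOn (fun t => M t * y t) (Set.Ioi 0))
    (z0 : ∫ t in Set.Ioi 0, M t = 0) (z1 : ∫ t in Set.Ioi 0, M t * y t = 0)
    (hinit : ∀ t d, 0 < t → t < d → 0 ≤ M d → 0 < M t) : False := by
  have hy' : ∀ s t, 0 < s → s < t → y t < y s := fun s t hs hst => hy hs (hs.trans hst) hst
  by_cases hP : ∃ d, 0 < d ∧ 0 ≤ M d
  swap
  · push Not at hP
    obtain ⟨t, ht0, -, ht⟩ := exists_eq_zero_of_setIntegral_eq_zero (f := fun t => - M t) i0.neg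
      (fun t ht => by linarith [hP t ht]) (by rw [integral_neg, z0, neg_zero]) le_rfl one_pos
    linarith [hP t ht0]
  by_cases hB : BddAbove {d | 0 < d ∧ 0 ≤ M d}
  swap
  · have hpos : ∀ t, 0 < t → 0 < M t := fun t ht => by
      obtain ⟨d, hd, htd⟩ := not_bddAbove_iff.1 hB t
      exact hinit t d ht htd hd.2
    obtain ⟨t, ht0, -, ht⟩ := exists_eq_zero_of_setIntegral_eq_zero i0
      (fun t ht => (hpos t ht).le) z0 le_rfl one_pos
    linarith [hpos t ht0]
  set q := sSup {d | 0 < d ∧ 0 ≤ M d} with hq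
  have hq0 : 0 < q := by
    obtain ⟨d, hd⟩ := hP
    exact hd.1.trans_le (le_csSup hB hd)
  have hlt : ∀ t, 0 < t → t < q → 0 < M t := fun t ht htq => by
    obtain ⟨d, hd, htd⟩ := exists_lt_of_lt_csSup hP htq
    exact hinit t d ht htd hd.2
  have hgt : ∀ t, q < t → M t < 0 := fun t ht => by
    by_contra! h
    exact absurd (le_csSup hB (⟨hq0.trans ht, h⟩ : t ∈ {d | 0 < d ∧ 0 ≤ M d})) (not_le.2 ht)
  obtain ⟨j1, j2⟩ := setIntegral_mul_sub_const i0 i1 z0 z1 (y q)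
  obtain ⟨t, ht0, htq, ht⟩ := exists_eq_zero_of_setIntegral_eq_zero j1
    (fun t ht => by
      rcases lt_trichotomy t q with h | h | h
      · exact (mul_pos (hlt t ht h) (sub_pos.2 (hy' t q ht h))).le
      · simp [h]
      · exact (mul_pos_of_neg_of_neg (hgt t h) (sub_neg.2 (hy' q t hq0 h))).le) j2 le_rfl hq0
  exact absurd ht (mul_pos (hlt t ht0 htq) (sub_pos.2 (hy' t q ht0 htq))).ne'

/-! ### The signed gamma weight in the folding variable -/

noncomputable def side (s : ℝ) : ℝ := if s ≤ 1 then 1 else -1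

/-- The density `e^{-as} s^{x-1}`, signed by the side of `1`. -/
noncomputable def signedWeight (x a s : ℝ) : ℝ :=
  side s * Real.exp ((x - 1) * Real.log s - a * s)

noncomputable def branchValue (b δ : ℝ) : ℝ :=
  Real.log (lowerBranch δ) - Real.log b - lowerBranch δ

noncomputable def branchFactor (x a b δ : ℝ) : ℝ :=
  b⁻¹ * Real.exp ((x - 1) * (Real.log (lowerBranch δ) - Real.log b) - a * (b⁻¹ * lowerBranch δ)) /
    (Real.exp δ - 1) ^ 2

/-- Folded density of `signedWeight` in `δ`, with `s = v / b`. -/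
noncomputable def branchDensity (x a b δ : ℝ) : ℝ :=
  branchFactor x a b δ * (side (b⁻¹ * lowerBranch δ) * lowerDensity δ +
    side (b⁻¹ * upperBranch δ) * (Real.exp ((x - a * b⁻¹) * δ) * upperDensity δ))

theorem branchFactor_pos (x a : ℝ) {b δ : ℝ} (hb : 0 < b) (hδ : 0 < δ) :
    0 < branchFactor x a b δ :=
  div_pos (mul_pos (inv_pos.2 hb) (Real.exp_pos _)) (pow_pos (exp_sub_one_pos hδ) 2)

theorem strictAntiOn_branchValue (b : ℝ) : StrictAntiOn (branchValue b) (Set.Ioi 0) := by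
  intro s hs t ht hst
  have h := strictAntiOn_lowerBranch hs ht hst
  have h0 := lowerBranch_pos ht
  have h1 := lowerBranch_lt_one hs
  have h2 := lowerBranch_pos hs
  have h3 := Real.one_sub_inv_le_log_of_pos (div_pos h2 h0)
  rw [Real.log_div h2.ne' h0.ne', inv_div] at h3
  have h4 : lowerBranch s - lowerBranch t < 1 - lowerBranch t / lowerBranch s := by
    rw [lt_sub_iff_add_lt, ← sub_pos]
    have : 1 - (lowerBranch s - lowerBranch t + lowerBranch t / lowerBranch s) =
        (1 - lowerBranch s) * (lowerBranch s - lowerBranch t) / lowerBranch s := by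
      field_simp; ring
    rw [this]
    exact div_pos (mul_pos (by linarith) (by linarith)) h2
  unfold branchValue
  linarith

/-- Both preimages give `log s - b s` the same value. Passing from lower to upper multiplies `s` by
`e^δ` and adds `δ / b` to it, so the weight together with the Jacobian factor `e^δ` gains `e^{(x -
a/b)δ}`. -/
theorem branchDensity_mul_pow (x a : ℝ) {b δ : ℝ} (hb : 0 < b) (hδ : 0 < δ) (k : ℕ) :
    b⁻¹ * (lowerDensity δ / (Real.exp δ - 1) ^ 2 *
        (signedWeight x a (b⁻¹ * lowerBranch δ) *
          (Real.log (b⁻¹ * lowerBranch δ) - b * (b⁻¹ * lowerBranch δ)) ^ k) +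
      Real.exp δ * upperDensity δ / (Real.exp δ - 1) ^ 2 *
        (signedWeight x a (b⁻¹ * upperBranch δ) *
          (Real.log (b⁻¹ * upperBranch δ) - b * (b⁻¹ * upperBranch δ)) ^ k)) =
    branchDensity x a b δ * branchValue b δ ^ k := by
  have h1 := lowerBranch_pos hδ
  have h2 := one_lt_upperBranch hδ
  have l1 : Real.log (b⁻¹ * lowerBranch δ) = Real.log (lowerBranch δ) - Real.log b := by
    rw [Real.log_mul (inv_pos.2 hb).ne' h1.ne', Real.log_inv]; ring
  have l2 : Real.log (b⁻¹ * upperBranch δ) = Real.log (lowerBranch δ) + δ - Real.log b := by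
    rw [Real.log_mul (inv_pos.2 hb).ne' (by linarith), Real.log_inv, log_upperBranch hδ]; ring
  have e1 : Real.log (b⁻¹ * lowerBranch δ) - b * (b⁻¹ * lowerBranch δ) = branchValue b δ := by
    rw [l1, mul_inv_cancel_left₀ hb.ne', branchValue]
  have e2 : Real.log (b⁻¹ * upperBranch δ) - b * (b⁻¹ * upperBranch δ) = branchValue b δ := by
    rw [l2, mul_inv_cancel_left₀ hb.ne', branchValue, upperBranch]; ring
  have e3 : Real.exp δ * Real.exp ((x - 1) * (Real.log (lowerBranch δ) + δ - Real.log b) -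
      a * (b⁻¹ * upperBranch δ)) = Real.exp ((x - 1) * (Real.log (lowerBranch δ) - Real.log b) -
      a * (b⁻¹ * lowerBranch δ)) * Real.exp ((x - a * b⁻¹) * δ) := by
    rw [← Real.exp_add, ← Real.exp_add, upperBranch]; congr 1; ring
  rw [e1, e2, signedWeight, signedWeight, l1, l2, branchDensity, branchFactor]
  linear_combination (b⁻¹ * upperDensity δ / (Real.exp δ - 1) ^ 2 * side (b⁻¹ * upperBranch δ) *
    branchValue b δ ^ k) * e3

theorem side_of_le {s : ℝ} (h : s ≤ 1) : side s = 1 := if_pos h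

theorem side_of_lt {s : ℝ} (h : 1 < s) : side s = -1 := if_neg (not_le.2 h)

theorem inv_mul_le_one_iff_le {b v : ℝ} (hb : 0 < b) : b⁻¹ * v ≤ 1 ↔ v ≤ b := by
  rw [inv_mul_le_iff₀ hb, mul_one]

theorem one_lt_inv_mul_iff_lt {b v : ℝ} (hb : 0 < b) : 1 < b⁻¹ * v ↔ b < v := by
  rw [lt_inv_mul_iff₀ hb, mul_one]

/-- Second-moment inequality: if the signed weight is orthogonal to `1` and to `log s - b s`, then
its integral against `(log s - b s)²` is negative. -/
theorem integral_signedWeight_mul_sq_neg {x a b : ℝ} (hb : 0 < b)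
    (hi : ∀ k : ℕ, IntegrableOn (fun s => signedWeight x a s * (Real.log s - b * s) ^ k)
      (Set.Ioi 0))
    (z0 : ∫ s in Set.Ioi 0, signedWeight x a s = 0)
    (z1 : ∫ s in Set.Ioi 0, signedWeight x a s * (Real.log s - b * s) = 0) :
    ∫ s in Set.Ioi 0, signedWeight x a s * (Real.log s - b * s) ^ 2 < 0 := by
  have key : ∀ k : ℕ,
      IntegrableOn (fun δ => branchDensity x a b δ * branchValue b δ ^ k) (Set.Ioi 0) ∧
      ∫ δ in Set.Ioi 0, branchDensity x a b δ * branchValue b δ ^ k =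
        ∫ s in Set.Ioi 0, signedWeight x a s * (Real.log s - b * s) ^ k := by
    intro k
    have h := integral_eq_integral_branches_div (hi k) hb
    have e : Set.EqOn _ (fun δ => branchDensity x a b δ * branchValue b δ ^ k) (Set.Ioi 0) :=
      fun δ hδ => branchDensity_mul_pow x a hb hδ k
    rwa [integrableOn_congr_fun e measurableSet_Ioi, setIntegral_congr_fun measurableSet_Ioi e] at h
  have k0 := key 0
  have k1 := key 1
  have k2 := key 2
  simp only [pow_zero, mul_one] at k0
  simp only [pow_one] at k1
  rw [z0] at k0
  rw [z1] at k1
  have hdiff : ∀ t, 0 < t → b⁻¹ * lowerBranch t ≤ 1 → 1 < b⁻¹ * upperBranch t →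
      branchDensity x a b t = branchFactor x a b t *
        (lowerDensity t - Real.exp ((x - a * b⁻¹) * t) * upperDensity t) := by
    intro t _ h1 h2
    rw [branchDensity, side_of_le h1, side_of_lt h2]; ring
  have hcross : ∀ t d, 0 < t → t < d → b⁻¹ * lowerBranch t ≤ 1 → 1 < b⁻¹ * upperBranch t →
      0 ≤ branchDensity x a b d → 0 < branchDensity x a b t := by
    intro t d ht htd h1 h2 hM
    have hd := ht.trans htd
    have h3 : b⁻¹ * lowerBranch d ≤ 1 := (inv_mul_le_one_iff_le hb).2
      ((strictAntiOn_lowerBranch ht hd htd).le.trans ((inv_mul_le_one_iff_le hb).1 h1))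
    have h4 : 1 < b⁻¹ * upperBranch d := (one_lt_inv_mul_iff_lt hb).2
      (((one_lt_inv_mul_iff_lt hb).1 h2).trans (strictMonoOn_upperBranch ht hd htd))
    rw [hdiff d hd h3 h4] at hM
    rw [hdiff t ht h1 h2]
    have := nonneg_of_mul_nonneg_right hM (branchFactor_pos x a hb hd)
    exact mul_pos (branchFactor_pos x a hb ht)
      (sub_pos.2 (exp_mul_upperDensity_lt ht htd (sub_nonneg.1 this)))
  rcases lt_or_ge b 1 with h1 | h1
  -- The point `s = 1` is `v = b`, here on the lower branch at parameter `p`; before `p` both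
  -- preimages exceed `1`.
  · obtain ⟨p, hp, hpb⟩ := image_lowerBranch.ge (⟨hb, h1⟩ : b ∈ Set.Ioo 0 1)
    rw [← k2.2]
    have hup : ∀ t, 0 < t → 1 < b⁻¹ * upperBranch t := fun t ht =>
      (one_lt_inv_mul_iff_lt hb).2 (h1.trans (one_lt_upperBranch ht))
    refine setIntegral_mul_sq_neg (strictAntiOn_branchValue b) k0.1 k1.1 k2.1 k0.2 k1.2 hp ?_ ?_
    · intro t ht htp
      have h2 : 1 < b⁻¹ * lowerBranch t := (one_lt_inv_mul_iff_lt hb).2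
        (hpb ▸ strictAntiOn_lowerBranch ht hp htp)
      rw [branchDensity, side_of_lt h2, side_of_lt (hup t ht)]
      refine mul_neg_of_pos_of_neg (branchFactor_pos x a hb ht) ?_
      have := lowerDensity_pos ht
      have := mul_pos (Real.exp_pos ((x - a * b⁻¹) * t)) (upperDensity_pos ht)
      linarith
    · intro t d hpt htd hM
      have ht := lt_of_lt_of_le hp hpt
      refine (hcross t d ht htd ((inv_mul_le_one_iff_le hb).2 ?_) (hup t ht) hM.le).le
      exact hpb ▸ strictAntiOn_lowerBranch.antitoneOn hp ht hpt
  -- Now every lower preimage is at most `1`, so there is no initial negative range.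
  · refine (not_orthogonal_of_single_crossing (strictAntiOn_branchValue b) k0.1 k1.1 k0.2 k1.2
      fun t d ht htd hM => ?_).elim
    have h2 : b⁻¹ * lowerBranch t ≤ 1 :=
      (inv_mul_le_one_iff_le hb).2 ((lowerBranch_lt_one ht).le.trans h1)
    rcases le_or_gt (b⁻¹ * upperBranch t) 1 with h3 | h3
    · rw [branchDensity, side_of_le h2, side_of_le h3]
      refine mul_pos (branchFactor_pos x a hb ht) ?_
      have := lowerDensity_pos ht
      have := mul_pos (Real.exp_pos ((x - a * b⁻¹) * t)) (upperDensity_pos ht)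
      linarith
    · exact hcross t d ht htd h2 h3 hM

/-! ### Signed moments and differentiation under the integral -/

noncomputable def momentIntegrand (i j : ℕ) (p : ℝ × ℝ) (s : ℝ) : ℝ :=
  signedWeight p.1 p.2 s * (Real.log s ^ i * s ^ j)

/-- The signed mixed moments `∫ sgn(1 - s) (log s)^i s^j e^{-as} s^{x-1} ds`, with `p = (x, a)`. -/
noncomputable def signedMoment (i j : ℕ) (p : ℝ × ℝ) : ℝ :=
  ∫ s in Set.Ioi 0, momentIntegrand i j p s

theorem measurable_momentIntegrand (i j : ℕ) (p : ℝ × ℝ) : Measurable (momentIntegrand i j p) := by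
  have : Measurable side := Measurable.ite measurableSet_Iic measurable_const measurable_const
  unfold momentIntegrand signedWeight
  fun_prop

theorem abs_side (s : ℝ) : |side s| = 1 := by
  unfold side; split_ifs <;> simp

theorem integrableOn_pow_mul_exp (j : ℕ) {q α : ℝ} (hq : -1 < q) (hα : 0 < α) :
    IntegrableOn (fun s => s ^ j * Real.exp (q * Real.log s - α * s)) (Set.Ioi 0) := by
  have h := integrableOn_rpow_mul_exp_neg_mul_rpow (p := 1) (s := q + j) (b := α)
    (by have : (0 : ℝ) ≤ j := j.cast_nonneg
        linarith) one_pos hα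
  refine (integrableOn_congr_fun (fun s hs => ?_) measurableSet_Ioi).1 h
  rw [Set.mem_Ioi] at hs
  simp only [Real.rpow_one]
  rw [Real.rpow_add hs, Real.rpow_natCast, Real.rpow_def_of_pos hs, mul_assoc, mul_left_comm,
    ← Real.exp_add]
  congr 2; ring

/-- Dominates the integrand for shapes within `r` of `x` and rates at least `a / 2`. One `r` in the
exponent pays for the change of shape, the other for `|log s|^i ≤ i! r^{-i} e^{r |log s|}`; the two
summands cover both signs of `log s`. -/
noncomputable def momentBound (i j : ℕ) (x a r s : ℝ) : ℝ :=
  i.factorial / r ^ i * (s ^ j * Real.exp ((x - 1 + 2 * r) * Real.log s - a / 2 * s) +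
    s ^ j * Real.exp ((x - 1 - 2 * r) * Real.log s - a / 2 * s))

theorem integrableOn_momentBound (i j : ℕ) {x a r : ℝ} (ha : 0 < a) (hr : 0 < r)
    (hrx : 2 * r < x) : IntegrableOn (momentBound i j x a r) (Set.Ioi 0) :=
  ((integrableOn_pow_mul_exp j (by linarith) (half_pos ha)).add
    (integrableOn_pow_mul_exp j (by linarith) (half_pos ha))).const_mul _

theorem abs_momentIntegrand_le (i j : ℕ) {x a r : ℝ} (hr : 0 < r) {p : ℝ × ℝ} (h1 : |p.1 - x| ≤ r)
    (h2 : a / 2 ≤ p.2) {s : ℝ} (hs : 0 < s) :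
    |momentIntegrand i j p s| ≤ momentBound i j x a r s := by
  set l := Real.log s
  have e1 : |l| ^ i ≤ i.factorial / r ^ i * Real.exp (r * |l|) := by
    have := Real.pow_div_factorial_le_exp (r * |l|) (by positivity) i
    rw [div_le_iff₀ (by positivity), mul_pow] at this
    rw [div_mul_eq_mul_div, le_div_iff₀ (by positivity)]
    linarith
  have e2 : (p.1 - 1) * l - p.2 * s ≤ (x - 1) * l + r * |l| - a / 2 * s := by
    have h3 : (p.1 - x) * l ≤ r * |l| := by
      refine (le_abs_self _).trans ?_
      rw [abs_mul]
      exact mul_le_mul_of_nonneg_right h1 (abs_nonneg l)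
    nlinarith
  have e3 : Real.exp (r * |l|) * Real.exp ((x - 1) * l + r * |l| - a / 2 * s) ≤
      Real.exp ((x - 1 + 2 * r) * l - a / 2 * s) + Real.exp ((x - 1 - 2 * r) * l - a / 2 * s) := by
    rw [← Real.exp_add]
    rcases abs_cases l with ⟨h, _⟩ | ⟨h, _⟩ <;> rw [h]
    · refine le_of_eq_of_le ?_ (le_add_of_nonneg_right (Real.exp_pos _).le)
      congr 1; ring
    · refine le_of_eq_of_le ?_ (le_add_of_nonneg_left (Real.exp_pos _).le)
      congr 1; ring
  calc |momentIntegrand i j p s|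
      = Real.exp ((p.1 - 1) * l - p.2 * s) * (|l| ^ i * s ^ j) := by
        rw [momentIntegrand, signedWeight, abs_mul, abs_mul, abs_side, one_mul, Real.abs_exp,
          abs_mul, abs_pow, abs_of_pos (pow_pos hs j)]
    _ ≤ Real.exp ((x - 1) * l + r * |l| - a / 2 * s) *
          (i.factorial / r ^ i * Real.exp (r * |l|) * s ^ j) := by
        gcongr
    _ = i.factorial / r ^ i * s ^ j *
          (Real.exp (r * |l|) * Real.exp ((x - 1) * l + r * |l| - a / 2 * s)) := by ring
    _ ≤ i.factorial / r ^ i * s ^ j * (Real.exp ((x - 1 + 2 * r) * l - a / 2 * s) +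
          Real.exp ((x - 1 - 2 * r) * l - a / 2 * s)) := by
        gcongr
    _ = momentBound i j x a r s := by rw [momentBound]; ring

theorem integrableOn_momentIntegrand (i j : ℕ) {p : ℝ × ℝ} (hx : 0 < p.1) (ha : 0 < p.2) :
    IntegrableOn (momentIntegrand i j p) (Set.Ioi 0) := by
  refine (integrableOn_momentBound i j (x := p.1) ha (r := p.1 / 4) (by linarith) (by linarith)).mono'
    (measurable_momentIntegrand i j p).aestronglyMeasurable ?_
  refine (ae_restrict_iff' measurableSet_Ioi).2 (Filter.Eventually.of_forall fun s hs => ?_)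
  exact abs_momentIntegrand_le i j (by linarith) (by simp; linarith) (by linarith) hs

theorem hasFDerivAt_momentIntegrand (i j : ℕ) (p : ℝ × ℝ) (s : ℝ) :
    HasFDerivAt (fun p => momentIntegrand i j p s)
      (momentIntegrand (i + 1) j p s • ContinuousLinearMap.fst ℝ ℝ ℝ -
        momentIntegrand i (j + 1) p s • ContinuousLinearMap.snd ℝ ℝ ℝ) p := by
  have h := ((((((hasFDerivAt_fst (𝕜 := ℝ) (p := p)).sub_const 1).mul_const (Real.log s)).sub
    ((hasFDerivAt_snd (𝕜 := ℝ) (p := p)).mul_const s)).exp).const_mul (side s)).mul_const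
    (Real.log s ^ i * s ^ j)
  refine h.congr_fderiv ?_
  ext <;> simp [momentIntegrand, signedWeight] <;> ring

theorem hasFDerivAt_signedMoment (i j : ℕ) {p : ℝ × ℝ} (hx : 0 < p.1) (ha : 0 < p.2) :
    HasFDerivAt (signedMoment i j) (signedMoment (i + 1) j p • ContinuousLinearMap.fst ℝ ℝ ℝ -
        signedMoment i (j + 1) p • ContinuousLinearMap.snd ℝ ℝ ℝ) p := by
  have hr : 0 < min (p.1 / 4) (p.2 / 2) := lt_min (by linarith) (by linarith)
  set r := min (p.1 / 4) (p.2 / 2)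
  have hr1 : r ≤ p.1 / 4 := min_le_left _ _
  have hr2 : r ≤ p.2 / 2 := min_le_right _ _
  have h := hasFDerivAt_integral_of_dominated_of_fderiv_le (𝕜 := ℝ)
    (μ := volume.restrict (Set.Ioi 0)) (F := fun p s => momentIntegrand i j p s)
    (F' := fun p s => momentIntegrand (i + 1) j p s • ContinuousLinearMap.fst ℝ ℝ ℝ -
        momentIntegrand i (j + 1) p s • ContinuousLinearMap.snd ℝ ℝ ℝ)
    (bound := fun s => momentBound (i + 1) j p.1 p.2 r s + momentBound i (j + 1) p.1 p.2 r s)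
    (Metric.ball_mem_nhds p hr)
    (Filter.Eventually.of_forall fun q => (measurable_momentIntegrand i j q).aestronglyMeasurable)
    (integrableOn_momentIntegrand i j hx ha)
    (((measurable_momentIntegrand (i + 1) j p).aestronglyMeasurable.smul_const _).sub
      ((measurable_momentIntegrand i (j + 1) p).aestronglyMeasurable.smul_const _))
    ?_
    ((integrableOn_momentBound (i + 1) j ha hr (by linarith)).add
      (integrableOn_momentBound i (j + 1) ha hr (by linarith)))
    (Filter.Eventually.of_forall fun s q _ => hasFDerivAt_momentIntegrand i j q s)
  · refine h.congr_fderiv ?_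
    have j1 := integrableOn_momentIntegrand (i + 1) j hx ha
    have j2 := integrableOn_momentIntegrand i (j + 1) hx ha
    rw [integral_sub (j1.smul_const _) (j2.smul_const _), integral_smul_const, integral_smul_const]
    rfl
  · refine (ae_restrict_iff' measurableSet_Ioi).2 (Filter.Eventually.of_forall fun s hs q hq => ?_)
    rw [Metric.mem_ball, Prod.dist_eq, max_lt_iff, Real.dist_eq, Real.dist_eq] at hq
    have h2 := abs_lt.1 hq.2
    have hq2 : p.2 / 2 ≤ q.2 := by linarith
    refine (norm_sub_le _ _).trans (add_le_add ?_ ?_)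
    · rw [norm_smul]
      refine (mul_le_of_le_one_right (norm_nonneg _) (ContinuousLinearMap.norm_fst_le ..)).trans ?_
      exact abs_momentIntegrand_le _ _ hr hq.1.le hq2 hs
    · rw [norm_smul]
      refine (mul_le_of_le_one_right (norm_nonneg _) (ContinuousLinearMap.norm_snd_le ..)).trans ?_
      exact abs_momentIntegrand_le _ _ hr hq.1.le hq2 hs

theorem hasStrictFDerivAt_signedMoment (i j : ℕ) {p : ℝ × ℝ} (hx : 0 < p.1) (ha : 0 < p.2) :
    HasStrictFDerivAt (signedMoment i j)
      (signedMoment (i + 1) j p • ContinuousLinearMap.fst ℝ ℝ ℝ -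
        signedMoment i (j + 1) p • ContinuousLinearMap.snd ℝ ℝ ℝ) p := by
  have hev : ∀ᶠ q : ℝ × ℝ in nhds p, 0 < q.1 ∧ 0 < q.2 :=
    (continuousAt_fst.eventually (lt_mem_nhds hx)).and
      (continuousAt_snd.eventually (lt_mem_nhds ha))
  refine hasStrictFDerivAt_of_hasFDerivAt_of_continuousAt
    (f' := fun q => signedMoment (i + 1) j q • ContinuousLinearMap.fst ℝ ℝ ℝ -
        signedMoment i (j + 1) q • ContinuousLinearMap.snd ℝ ℝ ℝ)
    (hev.mono fun q hq => hasFDerivAt_signedMoment i j hq.1 hq.2) ?_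
  exact ((hasFDerivAt_signedMoment (i + 1) j hx ha).continuousAt.smul continuousAt_const).sub
    ((hasFDerivAt_signedMoment i (j + 1) hx ha).continuousAt.smul continuousAt_const)

/-! ### The median as a zero of the signed moment -/

theorem signedWeight_of_le {x a s : ℝ} (h : s ≤ 1) :
    signedWeight x a s = Real.exp ((x - 1) * Real.log s - a * s) := by
  rw [signedWeight, side_of_le h, one_mul]

theorem signedWeight_of_lt {x a s : ℝ} (h : 1 < s) :
    signedWeight x a s = -Real.exp ((x - 1) * Real.log s - a * s) := by
  rw [signedWeight, side_of_lt h, neg_one_mul]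

theorem isGammaMedian_iff {x a : ℝ} (hx : 0 < x) :
    IsGammaMedian x a ↔ 0 < a ∧ signedMoment 0 0 (x, a) = 0 := by
  refine and_congr_right fun ha => ?_
  set φ : ℝ → ℝ := fun s => Real.exp ((x - 1) * Real.log s - a * s) with hφ
  set C := a * a ^ (x - 1)
  have hC : 0 < C := mul_pos ha (Real.rpow_pos_of_pos ha _)
  have hscale : ∀ s, 0 < s → Real.exp (-(a * s)) * (a * s) ^ (x - 1) = a ^ (x - 1) * φ s := by
    intro s hs
    simp only [hφ]
    rw [Real.mul_rpow ha.le hs.le, Real.rpow_def_of_pos hs, mul_left_comm, ← Real.exp_add]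
    congr 2; ring
  have e1 : ∫ t in (0 : ℝ)..a, Real.exp (-t) * t ^ (x - 1) = C * ∫ s in Set.Ioc 0 1, φ s := by
    have h := intervalIntegral.smul_integral_comp_mul_left (a := 0) (b := 1)
      (fun t => Real.exp (-t) * t ^ (x - 1)) a
    rw [mul_zero, mul_one] at h
    rw [← h, intervalIntegral.integral_of_le zero_le_one,
      setIntegral_congr_fun measurableSet_Ioc (fun s hs => hscale s hs.1), integral_const_mul,
      smul_eq_mul, mul_assoc]
  have e2 : ∫ t in Set.Ioi (0 : ℝ), Real.exp (-t) * t ^ (x - 1) = C * ∫ s in Set.Ioi 0, φ s := by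
    have h := integral_comp_mul_left_Ioi' (fun t => Real.exp (-t) * t ^ (x - 1)) 0 ha
    rw [mul_zero] at h
    rw [← h, setIntegral_congr_fun measurableSet_Ioi (fun s hs => hscale s hs), integral_const_mul,
      smul_eq_mul, mul_assoc]
  have hint : IntegrableOn φ (Set.Ioi 0) := by
    have := integrableOn_pow_mul_exp 0 (q := x - 1) (by linarith) ha
    simpa using this
  have h01 : IntegrableOn φ (Set.Ioc 0 1) := hint.mono_set Set.Ioc_subset_Ioi_self
  have h1 : IntegrableOn φ (Set.Ioi 1) := hint.mono_set (Set.Ioi_subset_Ioi zero_le_one)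
  have e3 : ∫ s in Set.Ioi 0, φ s = (∫ s in Set.Ioc 0 1, φ s) + ∫ s in Set.Ioi 1, φ s := by
    rw [← setIntegral_union (Set.Ioc_disjoint_Ioi le_rfl) measurableSet_Ioi h01 h1,
      Set.Ioc_union_Ioi_eq_Ioi zero_le_one]
  have hm := integrableOn_momentIntegrand 0 0 (p := (x, a)) hx ha
  have e4 : signedMoment 0 0 (x, a) = (∫ s in Set.Ioc 0 1, φ s) - ∫ s in Set.Ioi 1, φ s := by
    rw [signedMoment, ← Set.Ioc_union_Ioi_eq_Ioi zero_le_one,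
      setIntegral_union (Set.Ioc_disjoint_Ioi le_rfl) measurableSet_Ioi
        (hm.mono_set Set.Ioc_subset_Ioi_self) (hm.mono_set (Set.Ioi_subset_Ioi zero_le_one)),
      sub_eq_add_neg, ← integral_neg]
    congr 1
    · exact setIntegral_congr_fun measurableSet_Ioc fun s hs => by
        simp [momentIntegrand, signedWeight_of_le hs.2, hφ]
    · exact setIntegral_congr_fun measurableSet_Ioi fun s hs => by
        simp [momentIntegrand, signedWeight_of_lt (Set.mem_Ioi.1 hs), hφ]
  rw [e1, e2, e3, e4]
  constructor
  · intro h
    refine (mul_eq_zero_iff_left hC.ne').1 ?_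
    linear_combination 2 * h
  · intro h
    linear_combination C / 2 * h

theorem existsUnique_isGammaMedian {x : ℝ} (hx : 0 < x) : ∃! a, IsGammaMedian x a := by
  set f : ℝ → ℝ := fun t => Real.exp (-t) * t ^ (x - 1) with hf
  have hi : IntegrableOn f (Set.Ioi 0) := Real.GammaIntegral_convergent hx
  have hpos : ∀ t, 0 < t → 0 < f t := fun t ht =>
    mul_pos (Real.exp_pos _) (Real.rpow_pos_of_pos ht _)
  have hii : ∀ p q, 0 ≤ p → p ≤ q → IntervalIntegrable f volume p q := fun p q hp hpq =>
    (intervalIntegrable_iff_integrableOn_Ioc_of_le hpq).2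
      (hi.mono_set fun t ht => lt_of_le_of_lt hp ht.1)
  have hmono : ∀ p q, 0 ≤ p → p < q → ∫ t in (0 : ℝ)..p, f t < ∫ t in (0 : ℝ)..q, f t := by
    intro p q hp hpq
    rw [← sub_pos, intervalIntegral.integral_interval_sub_left
      (hii 0 q le_rfl (hp.trans hpq.le)) (hii 0 p le_rfl hp)]
    exact intervalIntegral.intervalIntegral_pos_of_pos_on (hii p q hp hpq.le)
      (fun t ht => hpos t (lt_of_le_of_lt hp ht.1)) hpq
  have hT : 0 < ∫ t in Set.Ioi 0, f t := by
    have := Real.Gamma_pos_of_pos hx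
    rwa [Real.Gamma_eq_integral hx] at this
  have hlim := intervalIntegral_tendsto_integral_Ioi 0 hi Filter.tendsto_id
  obtain ⟨R, hR0, hR⟩ := ((Filter.eventually_ge_atTop (0 : ℝ)).and
    (hlim.eventually (lt_mem_nhds (show (1 / 2) * ∫ t in Set.Ioi 0, f t <
      ∫ t in Set.Ioi 0, f t by linarith)))).exists
  have hcont : ContinuousOn (fun a => ∫ t in (0 : ℝ)..a, f t) (Set.Icc 0 R) := by
    have := intervalIntegral.continuousOn_primitive_interval (a := 0) (b := R) (f := f)
      (μ := volume) (by
        rw [Set.uIcc_of_le hR0, integrableOn_Icc_iff_integrableOn_Ioc]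
        exact hi.mono_set Set.Ioc_subset_Ioi_self)
    rwa [Set.uIcc_of_le hR0] at this
  obtain ⟨a, ha, hae⟩ := intermediate_value_Icc hR0 hcont
    (show (1 / 2) * ∫ t in Set.Ioi 0, f t ∈ Set.Icc _ _ from
      ⟨by simp only [intervalIntegral.integral_same]; linarith, hR.le⟩)
  have ha0 : 0 < a := by
    refine ha.1.lt_of_ne fun h => ?_
    subst h
    simp only [intervalIntegral.integral_same] at hae
    linarith
  refine ⟨a, ⟨ha0, hae⟩, fun c hc => ?_⟩
  have hce : ∫ t in (0 : ℝ)..c, f t = ∫ t in (0 : ℝ)..a, f t := hc.2.trans hae.symm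
  rcases lt_trichotomy c a with h | h | h
  · exact absurd hce (hmono c a hc.1.le h).ne
  · exact h
  · exact absurd hce (hmono a c ha0.le h).ne'

/-! ### Signs of the moments -/

/-- Since the zeroth moment vanishes, `s` may be replaced by `s - 1`, and `sgn(1 - s)(s - 1) ≤ 0`.
-/
theorem signedMoment_zero_one_neg {p : ℝ × ℝ} (hx : 0 < p.1) (ha : 0 < p.2)
    (h0 : signedMoment 0 0 p = 0) : signedMoment 0 1 p < 0 := by
  have i0 := integrableOn_momentIntegrand 0 0 hx ha
  have i1 := integrableOn_momentIntegrand 0 1 hx ha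
  have e : ∀ s, momentIntegrand 0 0 p s - momentIntegrand 0 1 p s =
      signedWeight p.1 p.2 s * (1 - s) := fun s => by simp [momentIntegrand]; ring
  have hnn : ∀ s, 0 < s → 0 ≤ momentIntegrand 0 0 p s - momentIntegrand 0 1 p s := by
    intro s _
    rw [e]
    rcases le_or_gt s 1 with h | h
    · rw [signedWeight_of_le h]
      exact mul_nonneg (Real.exp_pos _).le (by linarith)
    · rw [signedWeight_of_lt h]
      exact mul_nonneg_of_nonpos_of_nonpos (neg_nonpos.2 (Real.exp_pos _).le) (by linarith)
  have hI : ∫ s in Set.Ioi 0, (momentIntegrand 0 0 p s - momentIntegrand 0 1 p s) =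
      - signedMoment 0 1 p := by
    rw [integral_sub i0 i1]
    change signedMoment 0 0 p - signedMoment 0 1 p = _
    rw [h0, zero_sub]
  by_contra! hge
  have hz := le_antisymm (hI.trans_le (by linarith)) (setIntegral_nonneg measurableSet_Ioi hnn)
  obtain ⟨t, -, ht1, ht⟩ := exists_eq_zero_of_setIntegral_eq_zero (i0.sub i1) hnn hz le_rfl one_pos
  simp only [Pi.sub_apply, e, signedWeight_of_le ht1.le] at ht
  exact absurd ht (mul_pos (Real.exp_pos _) (by linarith)).ne'

theorem signedMoment_one_zero_neg {p : ℝ × ℝ} (hx : 0 < p.1) (ha : 0 < p.2) :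
    signedMoment 1 0 p < 0 := by
  have i1 := integrableOn_momentIntegrand 1 0 hx ha
  have e : ∀ s, momentIntegrand 1 0 p s = signedWeight p.1 p.2 s * Real.log s :=
    fun s => by simp [momentIntegrand]
  have hnn : ∀ s, 0 < s → 0 ≤ - momentIntegrand 1 0 p s := by
    intro s hs
    rw [e, ← mul_neg]
    rcases le_or_gt s 1 with h | h
    · rw [signedWeight_of_le h]
      exact mul_nonneg (Real.exp_pos _).le (neg_nonneg.2 (Real.log_nonpos hs.le h))
    · rw [signedWeight_of_lt h]
      exact mul_nonneg_of_nonpos_of_nonpos (neg_nonpos.2 (Real.exp_pos _).le)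
        (neg_nonpos.2 (Real.log_nonneg h.le))
  have hI : ∫ s in Set.Ioi 0, - momentIntegrand 1 0 p s = - signedMoment 1 0 p := integral_neg _
  by_contra! hge
  have hz := le_antisymm (hI.trans_le (by linarith)) (setIntegral_nonneg measurableSet_Ioi hnn)
  obtain ⟨t, ht0, ht1, ht⟩ := exists_eq_zero_of_setIntegral_eq_zero i1.neg hnn hz le_rfl one_pos
  simp only [Pi.neg_apply, e, signedWeight_of_le ht1.le, ← mul_neg] at ht
  exact absurd ht (mul_pos (Real.exp_pos _) (neg_pos.2 (Real.log_neg ht0 ht1))).ne'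

theorem signedMoment_quadratic_neg {p : ℝ × ℝ} (hx : 0 < p.1) (ha : 0 < p.2) {b : ℝ} (hb : 0 < b)
    (h0 : signedMoment 0 0 p = 0) (h1 : signedMoment 1 0 p - b * signedMoment 0 1 p = 0) :
    signedMoment 2 0 p - 2 * b * signedMoment 1 1 p + b ^ 2 * signedMoment 0 2 p < 0 := by
  have i := fun i j => integrableOn_momentIntegrand i j hx ha
  have e1 : (fun s => signedWeight p.1 p.2 s * (Real.log s - b * s)) =
      fun s => momentIntegrand 1 0 p s - b * momentIntegrand 0 1 p s := by
    ext s; simp [momentIntegrand]; ring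
  have e2 : (fun s => signedWeight p.1 p.2 s * (Real.log s - b * s) ^ 2) =
      fun s => momentIntegrand 2 0 p s - 2 * b * momentIntegrand 1 1 p s +
        b ^ 2 * momentIntegrand 0 2 p s := by
    ext s; simp [momentIntegrand]; ring
  have e0 : signedWeight p.1 p.2 = momentIntegrand 0 0 p := by
    ext s; simp [momentIntegrand]
  have i2 : IntegrableOn (fun s => momentIntegrand 2 0 p s - 2 * b * momentIntegrand 1 1 p s)
    (Set.Ioi 0) := (i 2 0).sub ((i 1 1).const_mul _)
  have key := integral_signedWeight_mul_sq_neg (x := p.1) (a := p.2) hb ?_ ?_ ?_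
  · rw [e2, integral_add i2 ((i 0 2).const_mul _), integral_sub (i 2 0) ((i 1 1).const_mul _),
      integral_const_mul, integral_const_mul] at key
    exact key
  · intro k
    have e : (fun s => signedWeight p.1 p.2 s * (Real.log s - b * s) ^ k) = fun s =>
        ∑ l ∈ Finset.range (k + 1), (-b) ^ (k - l) * (k.choose l) * momentIntegrand l (k - l) p s := by
      ext s
      rw [sub_eq_add_neg, ← neg_mul, add_pow, Finset.mul_sum]
      refine Finset.sum_congr rfl fun l _ => ?_
      rw [momentIntegrand, mul_pow]; ring
    rw [e]
    exact integrable_finsetSum _ fun l _ => (i l (k - l)).const_mul _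
  · rw [e0]; exact h0
  · rw [e1, integral_sub (i 1 0) ((i 0 1).const_mul _), integral_const_mul]
    exact h1

/-! ### Implicit differentiation of the median -/

theorem hasDerivAt_signedMoment_comp (i j : ℕ) {m : ℝ → ℝ} {m' x : ℝ} (hx : 0 < x)
    (hm : 0 < m x) (h : HasDerivAt m m' x) :
    HasDerivAt (fun x => signedMoment i j (x, m x))
      (signedMoment (i + 1) j (x, m x) - signedMoment i (j + 1) (x, m x) * m') x := by
  have := (hasFDerivAt_signedMoment i j (p := (x, m x)) hx hm).comp_hasDerivAt x
    ((hasDerivAt_id x).prodMk h)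
  refine this.congr_deriv ?_
  simp

theorem differentiableAt_gammaMedian {m : ℝ → ℝ} (hm : ∀ x, 0 < x → IsGammaMedian x (m x)) {x : ℝ}
    (hx : 0 < x) : DifferentiableAt ℝ m x := by
  obtain ⟨ha, h0⟩ := (isGammaMedian_iff hx).1 (hm x hx)
  have hs := hasStrictFDerivAt_signedMoment 0 0 (p := (x, m x)) hx ha
  have hne : -signedMoment 0 1 (x, m x) ≠ 0 :=
    neg_ne_zero.2 (signedMoment_zero_one_neg (p := (x, m x)) hx ha h0).ne
  have hinv : ((signedMoment (0 + 1) 0 (x, m x) • ContinuousLinearMap.fst ℝ ℝ ℝ -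
      signedMoment 0 (0 + 1) (x, m x) • ContinuousLinearMap.snd ℝ ℝ ℝ) ∘L
        .inr ℝ ℝ ℝ).IsInvertible := by
    refine ⟨ContinuousLinearEquiv.unitsEquivAut ℝ (Units.mk0 _ hne), ?_⟩
    ext; simp
  have hψ := (hs.hasStrictFDerivAt_implicitFunctionOfProdDomain hinv).differentiableAt
  have hψt := hs.tendsto_implicitFunctionOfProdDomain hinv
  have hψ0 := hs.eventually_apply_implicitFunctionOfProdDomain hinv
  refine hψ.congr_of_eventuallyEq ?_
  filter_upwards [hψt.eventually (lt_mem_nhds ha), hψ0, lt_mem_nhds hx] with y h1 h2 h3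
  -- Uniqueness of the median identifies `m` with the implicit function near `x`.
  exact (existsUnique_isGammaMedian h3).unique (hm y h3)
    ((isGammaMedian_iff h3).2 ⟨h1, h2.trans h0⟩)

theorem deriv_gammaMedian {m : ℝ → ℝ} (hm : ∀ x, 0 < x → IsGammaMedian x (m x)) {x : ℝ}
    (hx : 0 < x) :
    signedMoment 1 0 (x, m x) - signedMoment 0 1 (x, m x) * deriv m x = 0 := by
  have h := hasDerivAt_signedMoment_comp 0 0 hx (hm x hx).1
    (differentiableAt_gammaMedian hm hx).hasDerivAt
  refine h.unique ((hasDerivAt_const x (0 : ℝ)).congr_of_eventuallyEq ?_)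
  filter_upwards [lt_mem_nhds hx] with y hy
  exact ((isGammaMedian_iff hy).1 (hm y hy)).2

theorem deriv_deriv_gammaMedian_pos {m : ℝ → ℝ} (hm : ∀ x, 0 < x → IsGammaMedian x (m x)) {x : ℝ}
    (hx : 0 < x) : DifferentiableAt ℝ (deriv m) x ∧ 0 < deriv (deriv m) x := by
  have hd := (differentiableAt_gammaMedian hm hx).hasDerivAt
  have hneg : ∀ y, 0 < y → signedMoment 0 1 (y, m y) < 0 := fun y hy =>
    signedMoment_zero_one_neg (p := (y, m y)) hy (hm y hy).1 ((isGammaMedian_iff hy).1 (hm y hy)).2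
  have h10 := hasDerivAt_signedMoment_comp 1 0 hx (hm x hx).1 hd
  have h01 := hasDerivAt_signedMoment_comp 0 1 hx (hm x hx).1 hd
  have hd2 : DifferentiableAt ℝ (deriv m) x := by
    -- Near `x`, `m'` equals a quotient of differentiable moments.
    refine (h10.div h01 (hneg x hx).ne).differentiableAt.congr_of_eventuallyEq ?_
    filter_upwards [lt_mem_nhds hx] with y hy
    simp only [Pi.div_apply]
    rw [eq_div_iff (hneg y hy).ne]
    linear_combination -deriv_gammaMedian hm hy
  refine ⟨hd2, ?_⟩
  have hz := (h10.sub (h01.mul hd2.hasDerivAt)).unique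
    ((hasDerivAt_const x (0 : ℝ)).congr_of_eventuallyEq (by
      filter_upwards [lt_mem_nhds hx] with y hy
      exact deriv_gammaMedian hm hy))
  have h1 := deriv_gammaMedian hm hx
  have hb : 0 < deriv m x := by
    have := signedMoment_one_zero_neg (p := (x, m x)) hx (hm x hx).1
    have := hneg x hx
    by_contra! hle
    nlinarith
  have hq := signedMoment_quadratic_neg (p := (x, m x)) hx (hm x hx).1 hb
    ((isGammaMedian_iff hx).1 (hm x hx)).2 (by linarith)
  have := hneg x hx
  norm_num at hz
  by_contra! hle
  have := mul_nonneg_of_nonpos_of_nonpos (hneg x hx).le hle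
  nlinarith

theorem theorem1 :
    (∀ x : ℝ, 0 < x → ∃! a : ℝ, IsGammaMedian x a) ∧
    ∀ m : ℝ → ℝ, (∀ x : ℝ, 0 < x → IsGammaMedian x (m x)) →
      (∀ x : ℝ, 0 < x →
        DifferentiableAt ℝ m x ∧ DifferentiableAt ℝ (deriv m) x ∧ 0 < deriv (deriv m) x) ∧
      StrictConvexOn ℝ (Set.Ioi (0 : ℝ)) m := by
  refine ⟨fun x hx => existsUnique_isGammaMedian hx, fun m hm => ⟨fun x hx =>
    ⟨differentiableAt_gammaMedian hm hx, deriv_deriv_gammaMedian_pos hm hx⟩, ?_⟩⟩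
  exact strictConvexOn_of_deriv2_pos' (convex_Ioi 0)
    (fun x hx => (differentiableAt_gammaMedian hm hx).continuousAt.continuousWithinAt)
    fun x hx => (deriv_deriv_gammaMedian_pos hm hx).2
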